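/- Let $p\ge 1$, and give $SO(p)$ the bi-invariant Riemannian metric that at the identity is $\langle A_1,A_2\rangle=-\tfrac12\operatorname{tr}(A_1A_2)$ on antisymmetric matrices; let $d_{SO}$ be its geodesic distance. An involution is an $R\in SO(p)$ with $R^2=I\ne R$, and its level is the dimension of its $(-1)$-eigenspace. An (even) sign change is $\sigma\in\{\pm1\}^p$ with $\prod_i\sigma_i=1$; its level is the number of $i$ with $\sigma_i=-1$, and $I_\sigma=\operatorname{diag}(\sigma_1,\dots,\sigma_p)\in SO(p)$. An involution $R$ is reducible by a sign change of level $m$ if $d_{SO}(RI_\sigma,I)<d_{SO}(R,I)$ for some even sign change $\sigma$ of level $m$. For $m$-dimensional subspaces $W,Z$ of $\mathbb R^p$ let $d_{Gr}(W,Z)=\bigl(\sum_{i=1}^m\varphi_i(W,Z)^2\bigr)^{1/2}$, where $\varphi_1,\dots,\varphi_m\in[0,\pi/2]$ are the principal angles between $W$ and $Z$. For $J\subseteq\{1,\dots,p\}$ let $\mathbb R^J=\{x\in\mathbb R^p: x_i=0\text{ for }i\notin J\}$. **Proposition.** Let $m,p$ be integers with $m$ even and $0<m\le p$. The following two statements are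 equivalent. 1. Every involution $R\in SO(p)$ of level $m$ is reducible by a sign change of level $m$. 2. For every $m$-dimensional subspace $W$ of $\mathbb R^p$ there is an $m$-element set $J\subseteq\{1,\dots,p\}$ with $$d_{Gr}(W,\mathbb R^J)^2<\frac{m\pi^2}{8}.$$ -/

import Mathlib

open scoped RealInnerProductSpace

noncomputable section

namespace SignChange

/-- The special orthogonal group `SO(p)`. -/
abbrev SO (p : ℕ) := Matrix.specialOrthogonalGroup (Fin p) ℝ

/-! ### The Riemannian distance on `SO(p)` -/

/-- The bi-invariant Riemannian metric on `SO(p)`, equal to `-(1/2) tr (A₁ A₂)` at the identity and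
extended by left translation: `g_U(X, Y) = -(1/2) tr (U⁻¹ X U⁻¹ Y)`. Tangent vectors at `U` are
regarded as `p × p` matrices. -/
def soMetric {p : ℕ} (U : SO p) (X Y : Matrix (Fin p) (Fin p) ℝ) : ℝ :=
  -(1 / 2) * Matrix.trace
    (((U⁻¹ : SO p) : Matrix (Fin p) (Fin p) ℝ) * X *
      (((U⁻¹ : SO p) : Matrix (Fin p) (Fin p) ℝ) * Y))

/-- `γ`, restricted to `[0, 1]`, is a `C¹` curve in `SO(p)` (an embedded submanifold of the space
of matrices) from `U` to `V`. Values of `γ` outside `[0, 1]` are irrelevant. -/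
structure IsCurve {p : ℕ} (γ : ℝ → SO p) (U V : SO p) : Prop where
  contDiffOn : ∀ i j : Fin p,
    ContDiffOn ℝ 1 (fun t => (γ t : Matrix (Fin p) (Fin p) ℝ) i j) (Set.Icc 0 1)
  source : γ 0 = U
  target : γ 1 = V

/-- The velocity `γ'(t)` as a matrix, for `t ∈ [0, 1]`. -/
def velocity {p : ℕ} (γ : ℝ → SO p) (t : ℝ) : Matrix (Fin p) (Fin p) ℝ :=
  Matrix.of fun i j =>
    derivWithin (fun s => (γ s : Matrix (Fin p) (Fin p) ℝ) i j) (Set.Icc 0 1) t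

/-- The Riemannian length of a curve. -/
def curveLength {p : ℕ} (γ : ℝ → SO p) : ℝ :=
  ∫ t in (0 : ℝ)..1, Real.sqrt (soMetric (γ t) (velocity γ t) (velocity γ t))

/-- The geodesic distance of `SO(p)`: the infimum of the lengths of the `C¹` curves from `U` to
`V` (there are such curves, as `SO(p)` is connected). -/
def dSO {p : ℕ} (U V : SO p) : ℝ :=
  sInf {l : ℝ | ∃ γ : ℝ → SO p, IsCurve γ U V ∧ l = curveLength γ}

/-! ### Involutions and sign changes -/

/-- `R` is an involution: `R² = I ≠ R`. -/
def IsInvolution {p : ℕ} (R : SO p) : Prop := R ^ 2 = 1 ∧ R ≠ 1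

/-- The level of an involution: the dimension of its `(-1)`-eigenspace. -/
def level {p : ℕ} (R : SO p) : ℕ :=
  Module.finrank ℝ (Module.End.eigenspace
    (Matrix.toEuclideanLin (R : Matrix (Fin p) (Fin p) ℝ)) (-1))

/-- Even sign changes: `σ ∈ {±1}^p` with `∏ σᵢ = 1`. -/
abbrev EvenSign (p : ℕ) := {σ : Fin p → ℤˣ // ∏ i, σ i = 1}

/-- The level of a sign change: the number of entries equal to `-1`. -/
def signLevel {p : ℕ} (σ : EvenSign p) : ℕ := (Finset.univ.filter fun i => σ.1 i = -1).card

/-- The sign-change matrix `diag(σ₁, …, σ_p) ∈ SO(p)`. -/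
def signMatrix {p : ℕ} (σ : EvenSign p) : SO p :=
  ⟨Matrix.diagonal fun i => ((σ.1 i : ℤ) : ℝ), by
    rw [Matrix.mem_specialOrthogonalGroup_iff, Matrix.mem_orthogonalGroup_iff]
    constructor
    · rw [Matrix.diagonal_transpose, Matrix.diagonal_mul_diagonal, ← Matrix.diagonal_one]
      congr 1
      funext i
      rcases Int.units_eq_one_or (σ.1 i) with h | h <;> simp [h]
    · rw [Matrix.det_diagonal]
      have h := congrArg (fun u : ℤˣ => ((u : ℤ) : ℝ)) σ.2
      simpa [Units.coe_prod] using h⟩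

/-- `R` is reducible by a sign change of level `m`. -/
def ReducibleBySignChange {p : ℕ} (m : ℕ) (R : SO p) : Prop :=
  ∃ σ : EvenSign p, signLevel σ = m ∧ dSO (R * signMatrix σ) 1 < dSO R 1

/-! ### Principal angles and the distance on the Grassmannian -/

/-- The Grassmannian of `m`-planes in `ℝ^p`. -/
abbrev Gr (m p : ℕ) :=
  {W : Submodule ℝ (EuclideanSpace ℝ (Fin p)) // Module.finrank ℝ W = m}

/-- `u₁, …, uₙ ∈ W` and `v₁, …, vₙ ∈ Z` are principal vectors: both families are orthonormal and,
for each `k`, the pair `(uₖ, vₖ)` maximizes `⟪x, y⟫` among the unit vectors `x ∈ W`, `y ∈ Z` with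
`x ⟂ u₁, …, uₖ₋₁` and `y ⟂ v₁, …, vₖ₋₁`. -/
structure IsPrincipalSystem {p n : ℕ} (W Z : Submodule ℝ (EuclideanSpace ℝ (Fin p)))
    (u v : Fin n → EuclideanSpace ℝ (Fin p)) : Prop where
  left_mem : ∀ k, u k ∈ W
  right_mem : ∀ k, v k ∈ Z
  left_orthonormal : Orthonormal ℝ u
  right_orthonormal : Orthonormal ℝ v
  inner_le : ∀ k, ∀ x ∈ W, ∀ y ∈ Z, ‖x‖ = 1 → ‖y‖ = 1 →
    (∀ i < k, ⟪u i, x⟫ = 0) → (∀ i < k, ⟪v i, y⟫ = 0) → ⟪x, y⟫ ≤ ⟪u k, v k⟫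

theorem isCompact_unit_orthogonal {p n : ℕ} (W : Submodule ℝ (EuclideanSpace ℝ (Fin p)))
    (u : Fin n → EuclideanSpace ℝ (Fin p)) :
    IsCompact {x : EuclideanSpace ℝ (Fin p) | x ∈ W ∧ ‖x‖ = 1 ∧ ∀ i, ⟪u i, x⟫ = 0} := by
  refine (isCompact_sphere (0 : EuclideanSpace ℝ (Fin p)) 1).of_isClosed_subset ?_ ?_
  · refine IsClosed.inter W.closed_of_finiteDimensional (IsClosed.inter ?_ ?_)
    · exact isClosed_eq continuous_norm continuous_const
    · have : {x : EuclideanSpace ℝ (Fin p) | ∀ i, ⟪u i, x⟫ = 0} = ⋂ i, {x | ⟪u i, x⟫ = 0} := by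
        ext x; simp
      change IsClosed {x : EuclideanSpace ℝ (Fin p) | ∀ i, ⟪u i, x⟫ = 0}
      rw [this]
      exact isClosed_iInter fun i =>
        isClosed_eq (continuous_const.inner continuous_id) continuous_const
  · rintro x ⟨-, hx, -⟩
    simpa using hx

theorem exists_unit_orthogonal {p n : ℕ} (W : Submodule ℝ (EuclideanSpace ℝ (Fin p)))
    (u : Fin n → EuclideanSpace ℝ (Fin p)) (hn : n < Module.finrank ℝ W) :
    ∃ x ∈ W, ‖x‖ = 1 ∧ ∀ i, ⟪u i, x⟫ = 0 := by
  let f : W →ₗ[ℝ] (Fin n → ℝ) :=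
    { toFun := fun x i => ⟪u i, (x : EuclideanSpace ℝ (Fin p))⟫
      map_add' := fun x y => by funext i; simp [inner_add_right]
      map_smul' := fun c x => by funext i; simp [inner_smul_right] }
  have hker : f.ker ≠ ⊥ := f.ker_ne_bot_of_finrank_lt (by simpa using hn)
  obtain ⟨x, hx, hx0⟩ := (Submodule.ne_bot_iff _).1 hker
  have hx0' : ‖(x : EuclideanSpace ℝ (Fin p))‖ ≠ 0 := by simpa using hx0
  refine ⟨‖(x : EuclideanSpace ℝ (Fin p))‖⁻¹ • (x : EuclideanSpace ℝ (Fin p)),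
    W.smul_mem _ x.2, ?_, fun i => ?_⟩
  · rw [norm_smul, norm_inv, norm_norm, inv_mul_cancel₀ hx0']
  · have : f x i = 0 := by rw [LinearMap.mem_ker.1 hx]; rfl
    rw [inner_smul_right]
    exact mul_eq_zero_of_right _ this

theorem exists_isPrincipalSystem {p : ℕ} (W Z : Submodule ℝ (EuclideanSpace ℝ (Fin p))) :
    ∀ n : ℕ, n ≤ Module.finrank ℝ W → n ≤ Module.finrank ℝ Z →
      ∃ uv : (Fin n → EuclideanSpace ℝ (Fin p)) × (Fin n → EuclideanSpace ℝ (Fin p)),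
        IsPrincipalSystem W Z uv.1 uv.2 := by
  intro n
  induction n with
  | zero =>
    intro _ _
    exact ⟨(Fin.elim0, Fin.elim0), fun k => k.elim0, fun k => k.elim0,
      ⟨fun k => k.elim0, fun k => k.elim0⟩, ⟨fun k => k.elim0, fun k => k.elim0⟩,
      fun k => k.elim0⟩
  | succ n ih =>
    intro hW hZ
    obtain ⟨⟨u, v⟩, h⟩ := ih (by omega) (by omega)
    obtain ⟨x₀, hx₀⟩ := exists_unit_orthogonal W u (by omega)
    obtain ⟨y₀, hy₀⟩ := exists_unit_orthogonal Z v (by omega)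
    obtain ⟨⟨a, b⟩, ⟨⟨haW, ha1, hau⟩, hbZ, hb1, hbv⟩, hmax⟩ :=
      ((isCompact_unit_orthogonal W u).prod (isCompact_unit_orthogonal Z v)).exists_isMaxOn
        ⟨(x₀, y₀), hx₀, hy₀⟩
        (f := fun q : EuclideanSpace ℝ (Fin p) × EuclideanSpace ℝ (Fin p) => ⟪q.1, q.2⟫)
        (continuous_fst.inner continuous_snd).continuousOn
    have key : ∀ (w : Fin n → EuclideanSpace ℝ (Fin p)) (c : EuclideanSpace ℝ (Fin p)),
        Orthonormal ℝ w → ‖c‖ = 1 → (∀ i, ⟪w i, c⟫ = 0) →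
        Orthonormal ℝ (Fin.snoc w c : Fin (n + 1) → EuclideanSpace ℝ (Fin p)) := by
      intro w c hw hc hwc
      refine ⟨fun i => ?_, fun i j hij => ?_⟩
      · refine Fin.lastCases ?_ (fun i => ?_) i
        · simpa using hc
        · simpa using hw.1 i
      · revert hij
        refine Fin.lastCases ?_ (fun i => ?_) i <;> refine Fin.lastCases ?_ (fun j => ?_) j
        · intro hij; exact absurd rfl hij
        · intro _; simpa [real_inner_comm] using hwc j
        · intro _; simpa using hwc i
        · intro hij
          simpa using hw.2 (fun e => hij (by rw [e]))
    refine ⟨(Fin.snoc u a, Fin.snoc v b), fun k => ?_, fun k => ?_,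
      key u a h.left_orthonormal ha1 hau, key v b h.right_orthonormal hb1 hbv, fun k => ?_⟩
    · refine Fin.lastCases ?_ (fun i => ?_) k
      · simpa using haW
      · simpa using h.left_mem i
    · refine Fin.lastCases ?_ (fun i => ?_) k
      · simpa using hbZ
      · simpa using h.right_mem i
    · refine Fin.lastCases ?_ (fun k => ?_) k
      · intro x hx y hy hx1 hy1 hux hvy
        have := hmax (a := (x, y))
          ⟨⟨hx, hx1, fun i => by simpa using hux i.castSucc (Fin.castSucc_lt_last i)⟩,
            hy, hy1, fun i => by simpa using hvy i.castSucc (Fin.castSucc_lt_last i)⟩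
        simpa using this
      · intro x hx y hy hx1 hy1 hux hvy
        have := h.inner_le k x hx y hy hx1 hy1
          (fun i hi => by simpa using hux i.castSucc (Fin.castSucc_lt_castSucc_iff.2 hi))
          (fun i hi => by simpa using hvy i.castSucc (Fin.castSucc_lt_castSucc_iff.2 hi))
        simpa using this

/-- A choice of principal vectors of two `m`-planes. -/
def principalVectors {m p : ℕ} (W Z : Gr m p) :
    (Fin m → EuclideanSpace ℝ (Fin p)) × (Fin m → EuclideanSpace ℝ (Fin p)) :=
  (exists_isPrincipalSystem W.1 Z.1 m W.2.ge Z.2.ge).choose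

theorem isPrincipalSystem_principalVectors {m p : ℕ} (W Z : Gr m p) :
    IsPrincipalSystem W.1 Z.1 (principalVectors W Z).1 (principalVectors W Z).2 :=
  (exists_isPrincipalSystem W.1 Z.1 m W.2.ge Z.2.ge).choose_spec

/-- The principal angles `φ₁ ≤ … ≤ φₘ` in `[0, π/2]` of two `m`-planes: `cos φₖ = ⟪uₖ, vₖ⟫` for
principal vectors `uₖ`, `vₖ`. The value is the same for every system of principal vectors. -/
def principalAngle {m p : ℕ} (W Z : Gr m p) (k : Fin m) : ℝ :=
  Real.arccos ⟪(principalVectors W Z).1 k, (principalVectors W Z).2 k⟫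

/-- The distance on the Grassmannian. -/
def dGr {m p : ℕ} (W Z : Gr m p) : ℝ :=
  Real.sqrt (∑ k, principalAngle W Z k ^ 2)

/-- The subspace `ℝ^J` of the vectors whose coordinates outside `J` vanish. -/
def coordSubspace {p : ℕ} (J : Finset (Fin p)) : Submodule ℝ (EuclideanSpace ℝ (Fin p)) where
  carrier := {x | ∀ i, i ∉ J → x i = 0}
  zero_mem' := fun _ _ => rfl
  add_mem' := fun {x y} hx hy i hi => by simp [hx i hi, hy i hi]
  smul_mem' := fun c x hx i hi => by simp [hx i hi]

theorem finrank_coordSubspace {p : ℕ} (J : Finset (Fin p)) :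
    Module.finrank ℝ (coordSubspace J) = J.card := by
  let e : coordSubspace J ≃ₗ[ℝ] (J → ℝ) :=
    { toFun := fun x i => (x : EuclideanSpace ℝ (Fin p)) i
      map_add' := fun x y => rfl
      map_smul' := fun c x => rfl
      invFun := fun y => ⟨WithLp.toLp 2 fun i => if h : i ∈ J then y ⟨i, h⟩ else 0,
        fun i hi => by simp [hi]⟩
      left_inv := fun x => by
        ext i
        by_cases h : i ∈ J
        · simp [h]
        · simp [h, x.2 i h]
      right_inv := fun y => by
        funext i
        simp }
  rw [e.finrank_eq]
  simp

/-- The coordinate `m`-plane `ℝ^J` for an `m`-element set `J` of indices. -/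
def coordPlane {m p : ℕ} (J : {J : Finset (Fin p) // J.card = m}) : Gr m p :=
  ⟨coordSubspace J.1, (finrank_coordSubspace J.1).trans J.2⟩

end SignChange

end

open SignChange

/-!
An involution `R` with `(-1)`-eigenspace `W` is the reflection `negOn M = 1 - 2 M Mᵀ`, where the
columns of `M` are an orthonormal basis of `W`, and a sign change of level `m` is such a reflection
for a coordinate plane `Z = ℝ^J`. If the columns `uₖ` of `M` and `vₖ` of `V` are principal vectors,
so that `Mᵀ V = diag (cos φₖ)`, then `negOn M * negOn V` rotates mutually orthogonal planes by the
angles `2 φₖ` (a plane shrinks to a fixed line where `φₖ = 0`), and its distance from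
the identity is `2 (∑ φₖ²)^(1/2)` (`dSO_negOn_mul_negOn`).

* Upper bound: rotating each `uₖ` onto `vₖ` at constant speed moves the first reflection onto the
  second and gives a curve of this length (`IsFrame.exists_curve`).
* Lower bound: for any orthonormal family `eᵢ`, a curve `γ` in `SO(p)` from `U` to `1` moves `eᵢ` on
  the unit sphere from `U eᵢ` to `eᵢ`, so that `∫ ‖γ' eᵢ‖` is at least the angle `θᵢ` between them
  (`angle_le_integral_norm_deriv`). As `∑ ‖γ' eᵢ‖² ≤ ‖γ'‖²` in the Frobenius norm, which is twice
  the squared Riemannian norm, the Cauchy–Schwarz inequality gives `∑ θᵢ² ≤ 2 length²`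
  (`IsCurve.sum_arccos_sq_le`). An orthonormal basis of the rotation planes has `θᵢ = 2 φₖ` twice
  for each `φₖ ≠ 0`, and the bound is sharp.

Hence `d_SO(R I_σ, I) = 2 d_Gr(W, ℝ^J)` (`dSO_mul_signMatrix`). Splitting an orthonormal basis of
`W` into two halves writes `R` itself as a product of two reflections in orthogonal `m/2`-planes,
with all principal angles `π / 2`, so that `d_SO(R, I)² = m π² / 2` (`dSO_involution`). Comparing
the two distances (`dSO_lt_iff`) gives the equivalence, since every `m`-plane with `m` even is the
`(-1)`-eigenspace of an involution in `SO(p)`.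
-/

namespace SignChange

open Set Filter Topology InnerProductGeometry Matrix

/-! ### Curves on the unit sphere -/

section Sphere

variable {E : Type*} [NormedAddCommGroup E] [InnerProductSpace ℝ E]

theorem angle_eq_two_mul_arcsin {x y : E} (hx : ‖x‖ = 1) (hy : ‖y‖ = 1) :
    angle x y = 2 * Real.arcsin (‖x - y‖ / 2) := by
  have hcos : Real.cos (angle x y) = ⟪x, y⟫ := by rw [cos_angle, hx, hy]; simp
  have h0 := angle_nonneg x y
  have hpi := angle_le_pi x y
  have hs0 : 0 ≤ Real.sin (angle x y / 2) :=
    Real.sin_nonneg_of_nonneg_of_le_pi (by linarith) (by linarith)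
  have hdist : ‖x - y‖ ^ 2 = (2 * Real.sin (angle x y / 2)) ^ 2 := by
    have h1 := norm_sub_sq_real x y
    have h2 := Real.cos_sq (angle x y / 2)
    rw [mul_div_cancel₀ _ (two_ne_zero' ℝ)] at h2
    have h3 := Real.sin_sq_add_cos_sq (angle x y / 2)
    rw [hx, hy] at h1
    nlinarith
  have hchord : ‖x - y‖ / 2 = Real.sin (angle x y / 2) := by
    rw [(sq_eq_sq₀ (norm_nonneg _) (by linarith)).1 hdist]; ring
  rw [hchord, Real.arcsin_sin (by linarith) (by linarith)]
  ring

/-- Arcs of the unit circle are longer than their chords by at most any given factor `c > 1`, once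
they are short enough. -/
theorem eventually_two_mul_arcsin_le {c : ℝ} (hc : 1 < c) :
    ∀ᶠ y in 𝓝 (0 : ℝ), 0 ≤ y → 2 * Real.arcsin (y / 2) ≤ c * y := by
  have hd : HasDerivAt (fun y : ℝ => 2 * Real.arcsin (y / 2)) 1 0 := by
    have h := (Real.hasDerivAt_arcsin (x := (0 : ℝ) / 2) (by norm_num) (by norm_num)).comp
      (0 : ℝ) ((hasDerivAt_id (0 : ℝ)).div_const 2)
    simpa using h.const_mul 2
  have hl := (hd.hasDerivWithinAt (s := univ)).limsup_norm_slope_le (r := c) (by simpa using hc)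
  rw [nhdsWithin_univ] at hl
  filter_upwards [hl] with y hy hy0
  rcases hy0.eq_or_lt with rfl | hpos
  · simp
  · have h1 : ‖y - 0‖⁻¹ * ‖2 * Real.arcsin (y / 2) - 2 * Real.arcsin (0 / 2)‖ < c := hy
    simp only [sub_zero, zero_div, Real.arcsin_zero, mul_zero, Real.norm_eq_abs,
      abs_of_pos hpos] at h1
    rw [inv_mul_lt_iff₀ hpos] at h1
    linarith [le_abs_self (2 * Real.arcsin (y / 2))]

/-- A `C¹` curve on the unit sphere is at least as long as the angle between its endpoints. The
angle to the starting point satisfies the triangle inequality, and its right slopes are bounded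
by the speed because arcs and chords agree to first order. -/
theorem angle_le_integral_norm_deriv {x x' : ℝ → E}
    (hx : ∀ t ∈ Icc (0 : ℝ) 1, HasDerivWithinAt x (x' t) (Icc 0 1) t)
    (hx' : ContinuousOn x' (Icc 0 1)) (h1 : ∀ t ∈ Icc (0 : ℝ) 1, ‖x t‖ = 1) :
    angle (x 0) (x 1) ≤ ∫ t in (0 : ℝ)..1, ‖x' t‖ := by
  -- the speed, extended continuously to the whole line
  set G : ℝ → ℝ := IccExtend (zero_le_one' ℝ) fun t => ‖x' t‖ with hG
  have hGc : Continuous G :=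
    continuous_IccExtend_iff.2 (continuousOn_iff_continuous_domRestrict.1 hx'.norm)
  have hGeq : ∀ t ∈ Icc (0 : ℝ) 1, G t = ‖x' t‖ := fun t ht => IccExtend_of_mem _ _ ht
  have hint : ∫ t in (0 : ℝ)..1, ‖x' t‖ = ∫ t in (0 : ℝ)..1, G t := by
    refine intervalIntegral.integral_congr fun t ht => ?_
    rw [uIcc_of_le zero_le_one] at ht
    exact (hGeq t ht).symm
  rw [hint]
  have hB : ∀ t, HasDerivAt (fun t => ∫ s in (0 : ℝ)..t, G s) (G t) t := fun t =>
    (hGc.integral_hasStrictDerivAt 0 t).hasDerivAt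
  have hne : ∀ t ∈ Icc (0 : ℝ) 1, x t ≠ 0 := fun t ht h => by
    have := h1 t ht; rw [h, norm_zero] at this; exact zero_ne_one this
  have h00 : (0 : ℝ) ∈ Icc (0 : ℝ) 1 := ⟨le_rfl, zero_le_one⟩
  have hxc : ContinuousOn x (Icc 0 1) := fun t ht => (hx t ht).continuousWithinAt
  have hf : ContinuousOn (fun t => angle (x 0) (x t)) (Icc 0 1) := fun t ht =>
    ContinuousAt.comp_continuousWithinAt (f := fun t => (x 0, x t))
      (g := fun q : E × E => angle q.1 q.2)
      (continuousAt_angle (hne 0 h00) (hne t ht)) (continuousWithinAt_const.prodMk (hxc t ht))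
  refine image_le_of_liminf_slope_right_le_deriv_boundary hf ?_
    (fun t _ => (hB t).continuousAt.continuousWithinAt)
    (fun t _ => (hB t).hasDerivWithinAt) ?_ (right_mem_Icc.2 zero_le_one)
  · simp [angle_self (hne 0 h00)]
  · intro t ht r hr
    have htI : t ∈ Icc (0 : ℝ) 1 := ⟨ht.1, ht.2.le⟩
    rw [hGeq t htI] at hr
    obtain ⟨r', hr1, hr2⟩ := exists_between hr
    have hr'0 : 0 < r' := (norm_nonneg _).trans_lt hr1
    have hmono : 𝓝[>] t ≤ 𝓝[Icc 0 1] t := by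
      rw [← nhdsWithin_Ioo_eq_nhdsGT ht.2]
      exact nhdsWithin_mono _ fun s hs => ⟨ht.1.trans hs.1.le, hs.2.le⟩
    have hslope := ((hx t htI).limsup_norm_slope_le hr1).filter_mono hmono
    have hto : Tendsto (fun z => ‖x t - x z‖) (𝓝[>] t) (𝓝 0) := by
      have h := ((hx t htI).continuousWithinAt.tendsto.const_sub (x t)).norm
      simp only [sub_self, norm_zero] at h
      exact h.mono_left hmono
    have harc := hto.eventually (eventually_two_mul_arcsin_le ((one_lt_div hr'0).2 hr2))
    refine Eventually.frequently ?_
    have hI : ∀ᶠ z in 𝓝[>] t, z ∈ Ioo t 1 := Ioo_mem_nhdsGT ht.2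
    filter_upwards [hslope, harc, hI] with z hz hz' hzI
    have hzpos : 0 < z - t := sub_pos.2 hzI.1
    have hzI' : z ∈ Icc (0 : ℝ) 1 := ⟨ht.1.trans hzI.1.le, hzI.2.le⟩
    have htri := angle_le_angle_add_angle (x 0) (x t) (x z)
    have hch := hz' (norm_nonneg _)
    rw [← angle_eq_two_mul_arcsin (h1 t htI) (h1 z hzI')] at hch
    rw [Real.norm_eq_abs, abs_of_pos hzpos, inv_mul_lt_iff₀ hzpos, norm_sub_rev] at hz
    rw [slope_def_field, div_lt_iff₀ hzpos]
    have hlt : r / r' * ‖x t - x z‖ < r / r' * ((z - t) * r') :=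
      mul_lt_mul_of_pos_left hz (div_pos (hr'0.trans hr2) hr'0)
    have he : r / r' * ((z - t) * r') = r * (z - t) := by field_simp
    linarith

end Sphere

/-! ### A lower bound for the length of curves in `SO(p)` -/

section LowerBound

variable {p : ℕ} {ι : Type*} [Fintype ι]

theorem transpose_mul_self_coe (U : SO p) :
    (U : Matrix (Fin p) (Fin p) ℝ)ᵀ * (U : Matrix (Fin p) (Fin p) ℝ) = 1 :=
  (mem_orthogonalGroup_iff' _ _).1 (mem_specialOrthogonalGroup_iff.1 U.2).1

theorem trace_transpose_mul_self_nonneg {m n : Type*} [Fintype m] [Fintype n]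
    (A : Matrix m n ℝ) : 0 ≤ trace (Aᵀ * A) := by
  simp only [trace, diag_apply, mul_apply, transpose_apply]
  exact Finset.sum_nonneg fun i _ => Finset.sum_nonneg fun j _ => mul_self_nonneg _

/-- Bessel's inequality for the Frobenius norm: restricting to the span of an orthonormal family
does not increase it. -/
theorem trace_mul_orthonormal_le [DecidableEq ι] (V : Matrix (Fin p) (Fin p) ℝ)
    {E : Matrix (Fin p) ι ℝ} (hE : Eᵀ * E = 1) :
    trace ((V * E)ᵀ * (V * E)) ≤ trace (Vᵀ * V) := by
  have h := trace_transpose_mul_self_nonneg (V * (1 - E * Eᵀ))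
  have hQ : (1 - E * Eᵀ) * (1 - E * Eᵀ) = 1 - E * Eᵀ := by
    have : E * Eᵀ * (E * Eᵀ) = E * Eᵀ := by
      rw [Matrix.mul_assoc, ← Matrix.mul_assoc Eᵀ, hE, Matrix.one_mul]
    rw [Matrix.mul_sub, Matrix.sub_mul, Matrix.sub_mul, this]; simp
  have h1 : trace ((V * (1 - E * Eᵀ))ᵀ * (V * (1 - E * Eᵀ)))
      = trace (Vᵀ * V) - trace ((V * E)ᵀ * (V * E)) := by
    have hT : (1 - E * Eᵀ)ᵀ = 1 - E * Eᵀ := by simp [transpose_mul]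
    rw [transpose_mul, hT, Matrix.mul_assoc, trace_mul_comm, Matrix.mul_assoc, Matrix.mul_assoc,
      hQ, ← Matrix.mul_assoc, Matrix.mul_sub, trace_sub, Matrix.mul_one, transpose_mul,
      ← Matrix.mul_assoc, trace_mul_comm _ Eᵀ]
    simp only [Matrix.mul_assoc]
  linarith

variable {γ : ℝ → SO p} {U V : SO p}

theorem IsCurve.hasDerivWithinAt (hγ : IsCurve γ U V) (i j : Fin p) {t : ℝ}
    (ht : t ∈ Icc (0 : ℝ) 1) :
    HasDerivWithinAt (fun s => (γ s : Matrix (Fin p) (Fin p) ℝ) i j) (velocity γ t i j)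
      (Icc 0 1) t :=
  ((hγ.contDiffOn i j).differentiableOn one_ne_zero t ht).hasDerivWithinAt

theorem IsCurve.continuousOn_velocity (hγ : IsCurve γ U V) :
    ContinuousOn (velocity γ) (Icc 0 1) := by
  refine continuousOn_pi.2 fun i => continuousOn_pi.2 fun j => ?_
  exact (hγ.contDiffOn i j).continuousOn_derivWithin (uniqueDiffOn_Icc zero_lt_one) le_rfl

/-- Differentiating `γᵀ γ = 1`: the velocity is tangent to the orthogonal group, that is, `γ⁻¹ γ'`
is antisymmetric. -/
theorem IsCurve.transpose_velocity_mul (hγ : IsCurve γ U V) {t : ℝ} (ht : t ∈ Icc (0 : ℝ) 1) :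
    (velocity γ t)ᵀ * (γ t : Matrix (Fin p) (Fin p) ℝ)
      = -((γ t : Matrix (Fin p) (Fin p) ℝ)ᵀ * velocity γ t) := by
  rw [eq_neg_iff_add_eq_zero]
  ext i j
  have h1 : HasDerivWithinAt (fun s => ∑ k, (γ s : Matrix (Fin p) (Fin p) ℝ) k i *
      (γ s : Matrix (Fin p) (Fin p) ℝ) k j) (∑ k, (velocity γ t k i *
        (γ t : Matrix (Fin p) (Fin p) ℝ) k j + (γ t : Matrix (Fin p) (Fin p) ℝ) k i *
          velocity γ t k j)) (Icc 0 1) t :=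
    HasDerivWithinAt.fun_sum fun k _ =>
      (hγ.hasDerivWithinAt k i ht).mul (hγ.hasDerivWithinAt k j ht)
  have h2 : (fun s => ∑ k, (γ s : Matrix (Fin p) (Fin p) ℝ) k i *
      (γ s : Matrix (Fin p) (Fin p) ℝ) k j) = fun _ => (1 : Matrix (Fin p) (Fin p) ℝ) i j := by
    funext s
    rw [← transpose_mul_self_coe (γ s)]
    simp [mul_apply]
  rw [h2] at h1
  have h3 := (uniqueDiffOn_Icc zero_lt_one t ht).eq_deriv _ h1 (hasDerivWithinAt_const t _ _)
  simpa [mul_apply, Finset.sum_add_distrib] using h3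

/-- Along a curve in `SO(p)` the squared Riemannian norm is half the squared Frobenius norm. -/
theorem IsCurve.soMetric_velocity (hγ : IsCurve γ U V) {t : ℝ} (ht : t ∈ Icc (0 : ℝ) 1) :
    soMetric (γ t) (velocity γ t) (velocity γ t)
      = 1 / 2 * trace ((velocity γ t)ᵀ * velocity γ t) := by
  have hinv : ((γ t)⁻¹ : SO p) = (γ t : Matrix (Fin p) (Fin p) ℝ)ᵀ := rfl
  have hr : (γ t : Matrix (Fin p) (Fin p) ℝ) * (γ t : Matrix (Fin p) (Fin p) ℝ)ᵀ = 1 :=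
    (mem_orthogonalGroup_iff _ _).1 (mem_specialOrthogonalGroup_iff.1 (γ t).2).1
  have h := hγ.transpose_velocity_mul ht
  have h' : (velocity γ t)ᵀ * velocity γ t = (velocity γ t)ᵀ * (γ t : Matrix (Fin p) (Fin p) ℝ) *
      ((γ t : Matrix (Fin p) (Fin p) ℝ)ᵀ * velocity γ t) := by
    rw [Matrix.mul_assoc, ← Matrix.mul_assoc (γ t).1, hr, Matrix.one_mul]
  rw [soMetric, hinv, h', h, Matrix.neg_mul, trace_neg]
  ring

/-- The columns of a moving orthogonal matrix trace curves on the unit sphere; by the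
Cauchy–Schwarz inequality and Bessel's inequality their lengths are jointly controlled by the
length of the curve. -/
theorem IsCurve.sum_arccos_sq_le [DecidableEq ι] (hγ : IsCurve γ U 1) {E : Matrix (Fin p) ι ℝ}
    (hE : Eᵀ * E = 1) :
    ∑ i, Real.arccos ((Eᵀ * (U : Matrix (Fin p) (Fin p) ℝ) * E) i i) ^ 2
      ≤ 2 * curveLength γ ^ 2 := by
  set x : ι → ℝ → EuclideanSpace ℝ (Fin p) := fun i t =>
    WithLp.toLp 2 fun a => ((γ t : Matrix (Fin p) (Fin p) ℝ) * E) a i with hx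
  set x' : ι → ℝ → EuclideanSpace ℝ (Fin p) := fun i t =>
    WithLp.toLp 2 fun a => (velocity γ t * E) a i with hx'
  have hderiv : ∀ i, ∀ t ∈ Icc (0 : ℝ) 1, HasDerivWithinAt (x i) (x' i t) (Icc 0 1) t := by
    intro i t ht
    have h : HasDerivWithinAt (fun s => fun a => ((γ s : Matrix (Fin p) (Fin p) ℝ) * E) a i)
        (fun a => (velocity γ t * E) a i) (Icc 0 1) t := by
      refine hasDerivWithinAt_pi.2 fun a => ?_
      simp only [mul_apply]
      exact HasDerivWithinAt.fun_sum fun k _ => (hγ.hasDerivWithinAt a k ht).mul_const _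
    exact ((PiLp.continuousLinearEquiv 2 ℝ fun _ : Fin p => ℝ).symm :
      (Fin p → ℝ) →L[ℝ] EuclideanSpace ℝ (Fin p)).hasFDerivAt.comp_hasDerivWithinAt t h
  have hcont : ∀ i, ContinuousOn (x' i) (Icc 0 1) := by
    intro i
    refine (PiLp.continuous_toLp 2 fun _ : Fin p => ℝ).comp_continuousOn
      (continuousOn_pi.2 fun a => ?_)
    have hv := hγ.continuousOn_velocity
    simp only [mul_apply]
    exact continuousOn_finsetSum _ fun k _ =>
      (continuousOn_pi.1 (continuousOn_pi.1 hv a) k).mul continuousOn_const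
  have hnorm : ∀ i t, ‖x i t‖ = 1 := by
    intro i t
    have h : ‖x i t‖ ^ 2 = (((γ t : Matrix (Fin p) (Fin p) ℝ) * E)ᵀ *
        ((γ t : Matrix (Fin p) (Fin p) ℝ) * E)) i i := by
      rw [EuclideanSpace.real_norm_sq_eq, mul_apply]
      exact Finset.sum_congr rfl fun a _ => by simp [hx, sq]
    rw [transpose_mul, Matrix.mul_assoc, ← Matrix.mul_assoc _ _ E, transpose_mul_self_coe,
      Matrix.one_mul, hE, one_apply_eq] at h
    nlinarith [norm_nonneg (x i t)]
  have hangle : ∀ i, angle (x i 0) (x i 1)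
      = Real.arccos ((Eᵀ * (U : Matrix (Fin p) (Fin p) ℝ) * E) i i) := by
    intro i
    rw [angle, hnorm, hnorm]
    congr 1
    rw [Matrix.mul_assoc, mul_apply]
    simp only [hx, hγ.source, hγ.target, EuclideanSpace.inner_eq_star_dotProduct]
    simp [dotProduct]
  have hle : ∀ i, Real.arccos ((Eᵀ * (U : Matrix (Fin p) (Fin p) ℝ) * E) i i)
      ≤ ∫ t in (0 : ℝ)..1, ‖x' i t‖ := fun i => by
    rw [← hangle]
    exact angle_le_integral_norm_deriv (hderiv i) (hcont i) fun t _ => hnorm i t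
  set θ : ι → ℝ := fun i => Real.arccos ((Eᵀ * (U : Matrix (Fin p) (Fin p) ℝ) * E) i i) with hθ
  have hθ0 : ∀ i, 0 ≤ θ i := fun i => Real.arccos_nonneg _
  have hsum : ∀ t, ∑ i, ‖x' i t‖ ^ 2 = trace ((velocity γ t * E)ᵀ * (velocity γ t * E)) := by
    intro t
    refine Finset.sum_congr rfl fun i _ => ?_
    rw [EuclideanSpace.real_norm_sq_eq, diag_apply, mul_apply]
    exact Finset.sum_congr rfl fun a _ => by simp [hx', sq]
  set S := ∑ i, θ i ^ 2 with hS
  have hS0 : 0 ≤ S := Finset.sum_nonneg fun i _ => sq_nonneg _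
  have hpt : ∀ t ∈ Icc (0 : ℝ) 1, ∑ i, θ i * ‖x' i t‖
      ≤ √S * √2 * √(soMetric (γ t) (velocity γ t) (velocity γ t)) := by
    intro t ht
    refine (Real.sum_mul_le_sqrt_mul_sqrt _ _ _).trans ?_
    rw [mul_assoc, ← Real.sqrt_mul zero_le_two, hγ.soMetric_velocity ht, hsum]
    refine mul_le_mul_of_nonneg_left (Real.sqrt_le_sqrt ?_) (Real.sqrt_nonneg _)
    linarith [trace_mul_orthonormal_le (velocity γ t) hE]
  have hi1 : ∀ i, IntervalIntegrable (fun t => θ i * ‖x' i t‖) MeasureTheory.volume 0 1 :=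
    fun i => ((hcont i).norm.const_mul (θ i)).intervalIntegrable_of_Icc zero_le_one
  have hcs : ContinuousOn (fun t => √(soMetric (γ t) (velocity γ t) (velocity γ t)))
      (Icc 0 1) := by
    refine ContinuousOn.congr (f := fun t => √(1 / 2 * trace ((velocity γ t)ᵀ * velocity γ t))) ?_
      fun t ht => by rw [hγ.soMetric_velocity ht]
    have hv := hγ.continuousOn_velocity
    have : Continuous fun A : Matrix (Fin p) (Fin p) ℝ => √(1 / 2 * trace (Aᵀ * A)) := by
      fun_prop
    exact this.comp_continuousOn hv
  have hkey : S ≤ √S * √2 * curveLength γ :=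
    calc S = ∑ i, θ i * θ i := Finset.sum_congr rfl fun i _ => sq _
      _ ≤ ∑ i, θ i * ∫ t in (0 : ℝ)..1, ‖x' i t‖ :=
        Finset.sum_le_sum fun i _ => mul_le_mul_of_nonneg_left (hle i) (hθ0 i)
      _ = ∫ t in (0 : ℝ)..1, ∑ i, θ i * ‖x' i t‖ := by
        rw [intervalIntegral.integral_finsetSum fun i _ => hi1 i]
        simp
      _ ≤ ∫ t in (0 : ℝ)..1, √S * √2 * √(soMetric (γ t) (velocity γ t) (velocity γ t)) :=
        intervalIntegral.integral_mono_on zero_le_one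
          (by simpa only [Finset.sum_fn] using IntervalIntegrable.sum Finset.univ fun i _ => hi1 i)
          ((hcs.const_mul _).intervalIntegrable_of_Icc zero_le_one) hpt
      _ = √S * √2 * curveLength γ := by
        rw [intervalIntegral.integral_const_mul, curveLength]
  change S ≤ _
  have hsq : √S * √S = S := Real.mul_self_sqrt hS0
  have h2 : √2 * √2 = (2 : ℝ) := Real.mul_self_sqrt zero_le_two
  rcases (Real.sqrt_nonneg S).eq_or_lt with h0 | h0
  · rw [← hsq, ← h0]; nlinarith [sq_nonneg (curveLength γ)]
  · have h3 : √S ≤ √2 * curveLength γ := by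
      refine le_of_mul_le_mul_left ?_ h0
      rw [hsq, ← mul_assoc]; exact hkey
    calc S = √S * √S := hsq.symm
      _ ≤ (√2 * curveLength γ) * (√2 * curveLength γ) :=
        mul_self_le_mul_self h0.le h3
      _ = 2 * curveLength γ ^ 2 := by rw [mul_mul_mul_comm, h2, sq]

end LowerBound

/-! ### Orthogonal involutions -/

section NegOn

variable {p : ℕ} {κ : Type*} [Fintype κ]

/-- For a matrix `M` with orthonormal columns: the orthogonal involution that is `-1` on the
column space of `M` and `1` on its orthogonal complement. -/
noncomputable def negOn (M : Matrix (Fin p) κ ℝ) : Matrix (Fin p) (Fin p) ℝ :=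
  1 - (2 : ℝ) • (M * Mᵀ)

theorem transpose_negOn (M : Matrix (Fin p) κ ℝ) : (negOn M)ᵀ = negOn M := by
  simp [negOn, transpose_mul]

variable [DecidableEq κ] {M : Matrix (Fin p) κ ℝ}

theorem transpose_mul_negOn (hM : Mᵀ * M = 1) : Mᵀ * negOn M = -Mᵀ := by
  rw [negOn, Matrix.mul_sub, Matrix.mul_smul, ← Matrix.mul_assoc, hM, Matrix.one_mul,
    Matrix.mul_one, two_smul]
  abel

theorem negOn_mul_self (hM : Mᵀ * M = 1) : negOn M * negOn M = 1 := by
  have h : negOn M * M = -M := by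
    simpa [transpose_negOn] using congrArg transpose (transpose_mul_negOn hM)
  conv_lhs => rw [negOn.eq_1 M, Matrix.sub_mul, ← negOn.eq_1 M]
  rw [Matrix.smul_mul, Matrix.mul_assoc, transpose_mul_negOn hM, negOn]
  simp

theorem det_negOn (hM : Mᵀ * M = 1) : (negOn M).det = (-1) ^ Fintype.card κ := by
  rw [negOn, ← Matrix.smul_mul, det_one_sub_mul_comm, Matrix.mul_smul, hM]
  have : (1 : Matrix κ κ ℝ) - (2 : ℝ) • 1 = -1 := by rw [two_smul]; abel
  rw [this, det_neg, det_one, mul_one]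

theorem negOn_mul_negOn_mem {K : Matrix (Fin p) κ ℝ} (hM : Mᵀ * M = 1) (hK : Kᵀ * K = 1) :
    negOn M * negOn K ∈ specialOrthogonalGroup (Fin p) ℝ := by
  rw [mem_specialOrthogonalGroup_iff, mem_orthogonalGroup_iff, transpose_mul, transpose_negOn,
    transpose_negOn, Matrix.mul_assoc, ← Matrix.mul_assoc (negOn K), negOn_mul_self hK,
    Matrix.one_mul, negOn_mul_self hM, det_mul, det_negOn hM, det_negOn hK, ← mul_pow]
  simp

end NegOn

/-! ### The distance from the identity of a product of two involutions -/

section Frame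

variable {p : ℕ} {κ : Type*} [Fintype κ] [DecidableEq κ]

/-- The columns `uₖ` of `M` are orthonormal, and the columns `nₖ` of `N` are orthogonal to them
and to one another. The pair `uₖ, nₖ` spans the plane of a rotation by the angle `φₖ`; if `φₖ ≠ 0`,
then `nₖ` is a unit vector (`d` records the squared norms, and `nₖ` may vanish if `φₖ = 0`). -/
structure IsFrame (M N : Matrix (Fin p) κ ℝ) (φ d : κ → ℝ) : Prop where
  left : Mᵀ * M = 1
  cross : Mᵀ * N = 0
  right : Nᵀ * N = diagonal d
  unit : ∀ k, φ k = 0 ∨ d k = 1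

/-- The frame `uₖ cos (t φₖ) + nₖ sin (t φₖ)` at time `t`. -/
noncomputable def rotFrame (M N : Matrix (Fin p) κ ℝ) (φ : κ → ℝ) (t : ℝ) : Matrix (Fin p) κ ℝ :=
  M * diagonal (fun k => Real.cos (t * φ k)) + N * diagonal (fun k => Real.sin (t * φ k))

/-- The velocity of `rotFrame`. -/
noncomputable def rotFrame' (M N : Matrix (Fin p) κ ℝ) (φ : κ → ℝ) (t : ℝ) : Matrix (Fin p) κ ℝ :=
  M * diagonal (fun k => -Real.sin (t * φ k) * φ k) +
    N * diagonal (fun k => Real.cos (t * φ k) * φ k)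

variable {M N : Matrix (Fin p) κ ℝ} {φ d : κ → ℝ}

theorem IsFrame.transpose_mul (h : IsFrame M N φ d) (a b a' b' : κ → ℝ) :
    (M * diagonal a + N * diagonal b)ᵀ * (M * diagonal a' + N * diagonal b')
      = diagonal fun k => a k * a' k + b k * d k * b' k := by
  have h' : Nᵀ * M = 0 := by simpa using congrArg transpose h.cross
  rw [transpose_add, Matrix.transpose_mul, Matrix.transpose_mul, diagonal_transpose,
    diagonal_transpose, Matrix.add_mul, Matrix.mul_add, Matrix.mul_add]
  have e : ∀ (A B : Matrix (Fin p) κ ℝ) (x y : κ → ℝ),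
      diagonal x * Aᵀ * (B * diagonal y) = diagonal x * (Aᵀ * B) * diagonal y := fun A B x y => by
    simp only [Matrix.mul_assoc]
  simp only [e, h.left, h.cross, h.right, h', Matrix.mul_zero, Matrix.zero_mul, Matrix.mul_one,
    diagonal_mul_diagonal, add_zero, zero_add, diagonal_add]

theorem IsFrame.rotFrame_orthonormal (h : IsFrame M N φ d) (t : ℝ) :
    (rotFrame M N φ t)ᵀ * rotFrame M N φ t = 1 := by
  rw [rotFrame, h.transpose_mul, ← diagonal_one]
  congr 1
  funext k
  rcases h.unit k with h0 | h1
  · simp [h0]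
  · rw [h1, mul_one, ← sq, ← sq, Real.cos_sq_add_sin_sq]

theorem IsFrame.rotFrame_mul_deriv (h : IsFrame M N φ d) (t : ℝ) :
    (rotFrame M N φ t)ᵀ * rotFrame' M N φ t = 0 := by
  rw [rotFrame, rotFrame', h.transpose_mul, ← diagonal_zero]
  congr 1
  funext k
  rcases h.unit k with h0 | h1
  · simp [h0]
  · rw [h1]; ring

theorem IsFrame.rotFrame_deriv_mul (h : IsFrame M N φ d) (t : ℝ) :
    (rotFrame' M N φ t)ᵀ * rotFrame' M N φ t = diagonal fun k => φ k ^ 2 := by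
  rw [rotFrame', h.transpose_mul]
  congr 1
  funext k
  rcases h.unit k with h0 | h1
  · simp [h0]
  · rw [h1]; linear_combination φ k ^ 2 * Real.sin_sq_add_cos_sq (t * φ k)

theorem hasDerivAt_rotFrame (t : ℝ) (i : Fin p) (k : κ) :
    HasDerivAt (fun s => rotFrame M N φ s i k) (rotFrame' M N φ t i k) t := by
  simp only [rotFrame, rotFrame', Matrix.add_apply, mul_diagonal]
  have hl : HasDerivAt (fun s => s * φ k) (φ k) t := by
    simpa using (hasDerivAt_id t).mul_const (φ k)
  exact (hl.cos.const_mul _).add (hl.sin.const_mul _)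

/-- The curve `t ↦ negOn (rotFrame t) * negOn (rotFrame 1)` of matrices. For a frame it runs in
`SO(p)` at constant speed and ends at the identity. -/
noncomputable def geodesic (M N : Matrix (Fin p) κ ℝ) (φ : κ → ℝ) (t : ℝ) :
    Matrix (Fin p) (Fin p) ℝ :=
  negOn (rotFrame M N φ t) * negOn (rotFrame M N φ 1)

/-- The velocity of `geodesic`. -/
noncomputable def geodesic' (M N : Matrix (Fin p) κ ℝ) (φ : κ → ℝ) (t : ℝ) :
    Matrix (Fin p) (Fin p) ℝ :=
  (-(2 : ℝ) • (rotFrame' M N φ t * (rotFrame M N φ t)ᵀ +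
    rotFrame M N φ t * (rotFrame' M N φ t)ᵀ)) * negOn (rotFrame M N φ 1)

theorem hasDerivAt_geodesic (t : ℝ) (i j : Fin p) :
    HasDerivAt (fun s => geodesic M N φ s i j) (geodesic' M N φ t i j) t := by
  simp only [geodesic, geodesic']
  simp only [mul_apply (N := negOn (rotFrame M N φ 1))]
  refine HasDerivAt.fun_sum fun l _ => HasDerivAt.mul_const ?_ _
  simp only [negOn, Matrix.sub_apply, Matrix.smul_apply, Matrix.add_apply, mul_apply,
    transpose_apply, smul_eq_mul, ← Finset.sum_add_distrib, neg_mul]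
  refine HasDerivAt.const_sub _ (HasDerivAt.const_mul _ (HasDerivAt.fun_sum fun k _ => ?_))
  exact (hasDerivAt_rotFrame t i k).mul (hasDerivAt_rotFrame t l k)

theorem contDiff_geodesic (i j : Fin p) : ContDiff ℝ 1 fun s => geodesic M N φ s i j := by
  have hW : ∀ i k, ContDiff ℝ 1 fun s => rotFrame M N φ s i k := fun i k => by
    simp only [rotFrame, Matrix.add_apply, mul_diagonal]
    fun_prop
  simp only [geodesic]
  simp only [mul_apply (N := negOn (rotFrame M N φ 1))]
  refine ContDiff.sum fun l _ => ContDiff.mul ?_ contDiff_const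
  simp only [negOn, Matrix.sub_apply, Matrix.smul_apply, mul_apply, transpose_apply, smul_eq_mul]
  exact contDiff_const.sub (contDiff_const.mul (ContDiff.sum fun k _ => (hW i k).mul (hW l k)))

theorem IsFrame.trace_geodesic' (h : IsFrame M N φ d) (t : ℝ) :
    trace ((geodesic' M N φ t)ᵀ * geodesic' M N φ t) = 8 * ∑ k, φ k ^ 2 := by
  have hF := negOn_mul_self (h.rotFrame_orthonormal 1)
  have h1 := h.rotFrame_orthonormal t
  have h2 := h.rotFrame_mul_deriv t
  have h3 := h.rotFrame_deriv_mul t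
  have h4 : (rotFrame' M N φ t)ᵀ * rotFrame M N φ t = 0 := by
    simpa using congrArg transpose h2
  set W := rotFrame M N φ t
  set W' := rotFrame' M N φ t
  have hP : trace ((W' * Wᵀ + W * W'ᵀ) * (W' * Wᵀ + W * W'ᵀ)) = 2 * ∑ k, φ k ^ 2 := by
    have e1 : W' * Wᵀ * (W' * Wᵀ) = 0 := by
      rw [Matrix.mul_assoc, ← Matrix.mul_assoc Wᵀ, h2]; simp
    have e2 : W * W'ᵀ * (W * W'ᵀ) = 0 := by
      rw [Matrix.mul_assoc, ← Matrix.mul_assoc W'ᵀ, h4]; simp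
    have e3 : trace (W' * Wᵀ * (W * W'ᵀ)) = ∑ k, φ k ^ 2 := by
      rw [Matrix.mul_assoc, ← Matrix.mul_assoc Wᵀ, h1, Matrix.one_mul, trace_mul_comm, h3,
        trace_diagonal]
    have e4 : trace (W * W'ᵀ * (W' * Wᵀ)) = ∑ k, φ k ^ 2 := by
      rw [trace_mul_comm, e3]
    rw [Matrix.add_mul, Matrix.mul_add, Matrix.mul_add, e1, e2, zero_add, add_zero, trace_add,
      e3, e4, two_mul]
  have hT : (W' * Wᵀ + W * W'ᵀ)ᵀ = W' * Wᵀ + W * W'ᵀ := by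
    simp [Matrix.transpose_mul, add_comm]
  have hg : geodesic' M N φ t = (-(2 : ℝ) • (W' * Wᵀ + W * W'ᵀ)) * negOn (rotFrame M N φ 1) := rfl
  rw [hg, Matrix.transpose_mul, transpose_negOn, Matrix.mul_assoc, trace_mul_comm,
    Matrix.mul_assoc, Matrix.mul_assoc, hF, Matrix.mul_one, transpose_smul, hT, Matrix.smul_mul,
    Matrix.mul_smul, trace_smul, trace_smul, hP]
  simp only [smul_eq_mul]
  ring

/-- The product of two reflections in planes at angles `φₖ` is joined to the identity by a curve of
length `2 (∑ φₖ²)^(1/2)`, moving the first plane onto the second. -/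
theorem IsFrame.exists_curve (h : IsFrame M N φ d) {U : SO p}
    (hU : (U : Matrix (Fin p) (Fin p) ℝ) = negOn M * negOn (rotFrame M N φ 1)) :
    ∃ γ : ℝ → SO p, IsCurve γ U 1 ∧ curveLength γ = 2 * √(∑ k, φ k ^ 2) := by
  let γ : ℝ → SO p := fun t => ⟨geodesic M N φ t,
    negOn_mul_negOn_mem (h.rotFrame_orthonormal t) (h.rotFrame_orthonormal 1)⟩
  have hγ : IsCurve γ U 1 := by
    refine ⟨fun i j => (contDiff_geodesic i j).contDiffOn, Subtype.ext ?_, Subtype.ext ?_⟩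
    · change geodesic M N φ 0 = U
      rw [hU, geodesic]
      simp [rotFrame]
    · exact negOn_mul_self (h.rotFrame_orthonormal 1)
  refine ⟨γ, hγ, ?_⟩
  have hv : ∀ t ∈ Icc (0 : ℝ) 1, √(soMetric (γ t) (velocity γ t) (velocity γ t))
      = 2 * √(∑ k, φ k ^ 2) := by
    intro t ht
    have hvel : velocity γ t = geodesic' M N φ t := by
      ext i j
      exact (hasDerivAt_geodesic t i j).hasDerivWithinAt.derivWithin
        (uniqueDiffOn_Icc zero_lt_one t ht)
    rw [hγ.soMetric_velocity ht, hvel, h.trace_geodesic']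
    have : 1 / 2 * (8 * ∑ k, φ k ^ 2) = 2 ^ 2 * ∑ k, φ k ^ 2 := by ring
    rw [this, Real.sqrt_mul (by norm_num), Real.sqrt_sq zero_le_two]
  rw [curveLength, intervalIntegral.integral_congr (g := fun _ => 2 * √(∑ k, φ k ^ 2))]
  · simp
  · intro t ht
    rw [uIcc_of_le zero_le_one] at ht
    exact hv t ht

/-- The vectors `uₖ` and `nₖ` (where `φₖ ≠ 0`) are moved by the angle `2 φₖ`, so that no curve is
shorter than that of `IsFrame.exists_curve`. -/
theorem IsFrame.le_curveLength (h : IsFrame M N φ d) (hφ : ∀ k, φ k ∈ Icc 0 (Real.pi / 2))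
    {U : SO p} (hU : (U : Matrix (Fin p) (Fin p) ℝ) = negOn M * negOn (rotFrame M N φ 1))
    {γ : ℝ → SO p} (hγ : IsCurve γ U 1) : 2 * √(∑ k, φ k ^ 2) ≤ curveLength γ := by
  classical
  have hlen : 0 ≤ curveLength γ :=
    intervalIntegral.integral_nonneg zero_le_one fun t _ => Real.sqrt_nonneg _
  have h' : Nᵀ * M = 0 := by simpa using congrArg transpose h.cross
  let K := {k // φ k ≠ 0}
  let E : Matrix (Fin p) (κ ⊕ K) ℝ := fromCols M (N.submatrix id Subtype.val)
  have hE : Eᵀ * E = 1 := by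
    have hb : ∀ A : Matrix (Fin p) κ ℝ, Aᵀ * N.submatrix id (Subtype.val : K → κ)
        = (Aᵀ * N).submatrix id Subtype.val := fun A => rfl
    rw [transpose_fromCols, fromRows_mul_fromCols, h.left, hb, h.cross, transpose_submatrix,
      ← fromBlocks_one]
    congr 1
    · change (Nᵀ * M).submatrix _ _ = _
      rw [h']; rfl
    · ext i j
      change (Nᵀ * N) i j = _
      rw [h.right, diagonal_apply, one_apply]
      rw [(h.unit i).resolve_left i.2]
      exact if_congr Subtype.ext_iff.symm rfl rfl
  have hmul : rotFrame M N φ 1 = M * diagonal (fun k => Real.cos (φ k)) +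
      N * diagonal (fun k => Real.sin (φ k)) := by simp [rotFrame]
  set V := rotFrame M N φ 1
  have hMV : Mᵀ * V = diagonal fun k => Real.cos (φ k) := by
    rw [hmul, Matrix.mul_add, ← Matrix.mul_assoc, ← Matrix.mul_assoc, h.left, h.cross]; simp
  have hNV : Nᵀ * V = diagonal fun k => d k * Real.sin (φ k) := by
    rw [hmul, Matrix.mul_add, ← Matrix.mul_assoc, ← Matrix.mul_assoc, h', h.right,
      diagonal_mul_diagonal]
    simp
  have hNR : Nᵀ * negOn M = Nᵀ := by
    rw [negOn, Matrix.mul_sub, Matrix.mul_smul, ← Matrix.mul_assoc, h']; simp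
  -- compressions of a reflection in terms of the cross Gram matrix
  have hcomp : ∀ A : Matrix (Fin p) κ ℝ, Aᵀ * negOn V * A
      = Aᵀ * A - (2 : ℝ) • ((Aᵀ * V) * (Aᵀ * V)ᵀ) := fun A => by
    rw [negOn, Matrix.mul_sub, Matrix.sub_mul, Matrix.mul_one, Matrix.mul_smul, Matrix.smul_mul,
      Matrix.transpose_mul, transpose_transpose]
    simp only [Matrix.mul_assoc]
  have hM : Mᵀ * (U : Matrix (Fin p) (Fin p) ℝ) * M
      = diagonal fun k => Real.cos (2 * φ k) := by
    rw [hU, ← Matrix.mul_assoc, transpose_mul_negOn h.left, Matrix.neg_mul, Matrix.neg_mul, hcomp,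
      hMV, h.left, diagonal_transpose, diagonal_mul_diagonal]
    ext i j
    by_cases hij : i = j
    · subst hij; simp [Real.cos_two_mul]; ring
    · simp [hij]
  have hN : ∀ k : K, (Nᵀ * (U : Matrix (Fin p) (Fin p) ℝ) * N) k k = Real.cos (2 * φ k) := by
    intro k
    rw [hU, ← Matrix.mul_assoc, hNR, hcomp, hNV, h.right, diagonal_transpose,
      diagonal_mul_diagonal]
    simp [(h.unit k).resolve_left k.2, Real.cos_two_mul]
    linear_combination -2 * Real.sin_sq_add_cos_sq (φ k)
  have harc : ∀ k, Real.arccos (Real.cos (2 * φ k)) = 2 * φ k := fun k =>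
    Real.arccos_cos (by linarith [(hφ k).1]) (by linarith [(hφ k).2])
  have hK : ∑ k : K, φ k ^ 2 = ∑ k, φ k ^ 2 := by
    rw [← Finset.sum_filter_of_ne (p := fun k => φ k ≠ 0) (s := Finset.univ)
      (f := fun k => φ k ^ 2) fun k _ hk h0 => hk (by simp [h0])]
    exact (Finset.sum_subtype _ (by simp) fun k => φ k ^ 2).symm
  have key := hγ.sum_arccos_sq_le hE
  have hl : ∀ k, (Eᵀ * (U : Matrix (Fin p) (Fin p) ℝ) * E) (Sum.inl k) (Sum.inl k)
      = Real.cos (2 * φ k) := fun k => by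
    have : (Eᵀ * (U : Matrix (Fin p) (Fin p) ℝ) * E) (Sum.inl k) (Sum.inl k)
      = (Mᵀ * (U : Matrix (Fin p) (Fin p) ℝ) * M) k k := rfl
    rw [this, hM, diagonal_apply_eq]
  have hr : ∀ k, (Eᵀ * (U : Matrix (Fin p) (Fin p) ℝ) * E) (Sum.inr k) (Sum.inr k)
      = Real.cos (2 * φ k) := fun k => hN k
  simp only [Fintype.sum_sum_type, hl, hr, harc, mul_pow, ← Finset.mul_sum] at key
  rw [hK] at key
  have hS : 0 ≤ ∑ k, φ k ^ 2 := Finset.sum_nonneg fun k _ => sq_nonneg _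
  refine abs_le_of_sq_le_sq' ?_ hlen |>.2
  rw [mul_pow, Real.sq_sqrt hS]
  linarith

theorem IsFrame.dSO_eq (h : IsFrame M N φ d) (hφ : ∀ k, φ k ∈ Icc 0 (Real.pi / 2)) {U : SO p}
    (hU : (U : Matrix (Fin p) (Fin p) ℝ) = negOn M * negOn (rotFrame M N φ 1)) :
    dSO U 1 = 2 * √(∑ k, φ k ^ 2) := by
  obtain ⟨γ, hγ, hl⟩ := h.exists_curve hU
  refine IsLeast.csInf_eq ⟨⟨γ, hγ, hl.symm⟩, ?_⟩
  rintro l ⟨γ', hγ', rfl⟩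
  exact h.le_curveLength hφ hU hγ'

/-- Two orthonormal families with a diagonal Gram matrix, as principal vectors are, span the planes
of a frame. -/
theorem dSO_negOn_mul_negOn {V : Matrix (Fin p) κ ℝ} (hM : Mᵀ * M = 1) (hV : Vᵀ * V = 1)
    (hφ : ∀ k, φ k ∈ Icc 0 (Real.pi / 2)) (hMV : Mᵀ * V = diagonal fun k => Real.cos (φ k))
    {U : SO p} (hU : (U : Matrix (Fin p) (Fin p) ℝ) = negOn M * negOn V) :
    dSO U 1 = 2 * √(∑ k, φ k ^ 2) := by
  set C : Matrix κ κ ℝ := diagonal fun k => Real.cos (φ k) with hC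
  have hVM : Vᵀ * M = C := by simpa [hC] using congrArg transpose hMV
  have hsin : ∀ k, Real.sin (φ k) = 0 → φ k = 0 := fun k hk =>
    (Real.sin_eq_zero_iff_of_lt_of_lt (by linarith [(hφ k).1, Real.pi_pos])
      (by linarith [(hφ k).2, Real.pi_pos])).1 hk
  have hMX : Mᵀ * (V - M * C) = 0 := by
    rw [Matrix.mul_sub, ← Matrix.mul_assoc, hM, hMV, Matrix.one_mul, sub_self]
  have hXX : (V - M * C)ᵀ * (V - M * C) = diagonal fun k => Real.sin (φ k) ^ 2 := by
    have hT : Cᵀ = C := by simp [hC]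
    rw [transpose_sub, Matrix.sub_mul, Matrix.transpose_mul, hT, Matrix.mul_assoc C, hMX,
      Matrix.mul_sub, hV, ← Matrix.mul_assoc, hVM, hC, diagonal_mul_diagonal]
    ext i j
    by_cases hij : i = j
    · subst hij; simp [Real.sin_sq]; ring
    · simp [hij]
  -- where `sin φₖ = 0` the inverse is `0`, and the corresponding column of `N` vanishes
  let N : Matrix (Fin p) κ ℝ := (V - M * C) * diagonal fun k => (Real.sin (φ k))⁻¹
  have hF : IsFrame M N φ fun k =>
      (Real.sin (φ k))⁻¹ * Real.sin (φ k) ^ 2 * (Real.sin (φ k))⁻¹ := by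
    refine ⟨hM, ?_, ?_, fun k => ?_⟩
    · rw [← Matrix.mul_assoc, hMX, Matrix.zero_mul]
    · rw [Matrix.transpose_mul, diagonal_transpose, Matrix.mul_assoc,
        ← Matrix.mul_assoc (V - M * C)ᵀ, hXX, diagonal_mul_diagonal, diagonal_mul_diagonal]
      simp only [mul_assoc]
    · by_cases hk : Real.sin (φ k) = 0
      · exact Or.inl (hsin k hk)
      · right; field_simp
  refine hF.dSO_eq hφ (hU.trans ?_)
  congr 2
  ext a k
  simp only [rotFrame, one_mul, Matrix.add_apply, mul_diagonal, N, Matrix.mul_assoc,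
    diagonal_mul_diagonal, Matrix.sub_apply, hC]
  by_cases hk : Real.sin (φ k) = 0
  · have h0 : (V - M * C) a k = 0 := by
      have := congrFun (congrFun hXX k) k
      simp only [mul_apply, transpose_apply, diagonal_apply_eq] at this
      rw [hk, sq, zero_mul, Finset.sum_eq_zero_iff_of_nonneg fun i _ => mul_self_nonneg _] at this
      exact mul_self_eq_zero.1 (this a (Finset.mem_univ a))
    rw [hk, _root_.inv_zero]
    simpa [hC, sub_eq_zero] using h0
  · field_simp
    ring

end Frame

/-! ### Orthogonality of principal vectors -/

section Principal

variable {p n : ℕ} {W Z : Submodule ℝ (EuclideanSpace ℝ (Fin p))}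
  {u v : Fin n → EuclideanSpace ℝ (Fin p)}

theorem IsPrincipalSystem.symm (h : IsPrincipalSystem W Z u v) : IsPrincipalSystem Z W v u :=
  ⟨h.right_mem, h.left_mem, h.right_orthonormal, h.left_orthonormal,
    fun k x hx y hy hx1 hy1 hux hvy => by
      rw [real_inner_comm, real_inner_comm (u k)]
      exact h.inner_le k y hy x hx hy1 hx1 hvy hux⟩

theorem IsPrincipalSystem.inner_nonneg (h : IsPrincipalSystem W Z u v) (k : Fin n) :
    0 ≤ ⟪u k, v k⟫ := by
  have h1 := h.inner_le k (-u k) (W.neg_mem (h.left_mem k)) (v k) (h.right_mem k)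
    (by rw [norm_neg, h.left_orthonormal.1]) (h.right_orthonormal.1 k)
    (fun i hi => by rw [inner_neg_right, h.left_orthonormal.2 hi.ne, neg_zero])
    (fun i hi => h.right_orthonormal.2 hi.ne)
  rw [inner_neg_left] at h1
  linarith

/-- If a later vector `uₖ` were not orthogonal to `vⱼ`, then tilting `uⱼ` towards `uₖ` would
increase the inner product with `vⱼ`. -/
theorem IsPrincipalSystem.inner_eq_zero_of_lt (h : IsPrincipalSystem W Z u v) {j k : Fin n}
    (hjk : j < k) : ⟪u k, v j⟫ = 0 := by
  set c := ⟪u j, v j⟫ with hc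
  set d := ⟪u k, v j⟫ with hd
  have hc0 : 0 ≤ c := h.inner_nonneg j
  by_contra hne
  have hpos : 0 < c ^ 2 + d ^ 2 := by positivity
  -- the direction in the plane of `uⱼ` and `uₖ` closest to `vⱼ`
  set s := √(c ^ 2 + d ^ 2) with hs
  have hs0 : 0 < s := Real.sqrt_pos.2 hpos
  have hs2 : s ^ 2 = c ^ 2 + d ^ 2 := Real.sq_sqrt hpos.le
  have huu : ∀ i, ⟪u i, u i⟫ = 1 := fun i => by
    rw [real_inner_self_eq_norm_sq, h.left_orthonormal.1, one_pow]
  have hjk0 : ⟪u j, u k⟫ = 0 := h.left_orthonormal.2 hjk.ne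
  have hkj0 : ⟪u k, u j⟫ = 0 := h.left_orthonormal.2 hjk.ne'
  have hn : ‖c • u j + d • u k‖ = s := by
    have : ‖c • u j + d • u k‖ ^ 2 = s ^ 2 := by
      rw [← real_inner_self_eq_norm_sq, hs2]
      simp only [inner_add_left, inner_add_right, real_inner_smul_left, real_inner_smul_right,
        huu, hjk0, hkj0]
      ring
    exact (sq_eq_sq₀ (norm_nonneg _) hs0.le).1 this
  have h1 := h.inner_le j (s⁻¹ • (c • u j + d • u k))
    (W.smul_mem _ (W.add_mem (W.smul_mem _ (h.left_mem j)) (W.smul_mem _ (h.left_mem k))))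
    (v j) (h.right_mem j)
    (by rw [norm_smul, hn, norm_inv, Real.norm_of_nonneg hs0.le, inv_mul_cancel₀ hs0.ne'])
    (h.right_orthonormal.1 j)
    (fun i hi => by
      rw [inner_smul_right, inner_add_right, inner_smul_right, inner_smul_right,
        h.left_orthonormal.2 hi.ne, h.left_orthonormal.2 (hi.trans hjk).ne]
      simp)
    (fun i hi => h.right_orthonormal.2 hi.ne)
  rw [real_inner_smul_left, inner_add_left, real_inner_smul_left, real_inner_smul_left, ← hc,
    ← hd, inv_mul_le_iff₀ hs0] at h1
  have h2 : s ≤ c := by nlinarith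
  have h3 : 0 < d ^ 2 := by positivity
  nlinarith

theorem IsPrincipalSystem.inner_eq_zero (h : IsPrincipalSystem W Z u v) {j k : Fin n}
    (hjk : j ≠ k) : ⟪u j, v k⟫ = 0 := by
  rcases hjk.lt_or_gt with hlt | hgt
  · rw [real_inner_comm]; exact h.symm.inner_eq_zero_of_lt hlt
  · exact h.inner_eq_zero_of_lt hgt

end Principal

/-! ### Involutions and their eigenspaces -/

section ColMatrix

variable {p : ℕ} {κ : Type*}

/-- The matrix with columns `uₖ`. -/
def colMatrix (u : κ → EuclideanSpace ℝ (Fin p)) : Matrix (Fin p) κ ℝ := of fun a k => u k a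

theorem transpose_colMatrix_mul (u v : κ → EuclideanSpace ℝ (Fin p)) :
    (colMatrix u)ᵀ * colMatrix v = of fun i j => ⟪u i, v j⟫ := by
  ext i j
  simp only [mul_apply, transpose_apply, colMatrix, of_apply,
    EuclideanSpace.inner_eq_star_dotProduct, dotProduct]
  exact Finset.sum_congr rfl fun a _ => by simp [mul_comm]

theorem transpose_colMatrix_mul_self [DecidableEq κ] {u : κ → EuclideanSpace ℝ (Fin p)}
    (hu : Orthonormal ℝ u) :
    (colMatrix u)ᵀ * colMatrix u = 1 := by
  rw [transpose_colMatrix_mul]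
  ext i j
  rw [of_apply, orthonormal_iff_ite.1 hu, one_apply]

variable [Fintype κ]

theorem toEuclideanLin_colMatrix (u : κ → EuclideanSpace ℝ (Fin p))
    (x : EuclideanSpace ℝ (Fin p)) :
    toEuclideanLin (colMatrix u * (colMatrix u)ᵀ) x = ∑ k, ⟪u k, x⟫ • u k := by
  ext a
  rw [toLpLin_apply, ← mulVec_mulVec]
  simp only [mulVec, dotProduct, colMatrix, of_apply, transpose_apply, WithLp.ofLp_sum,
    WithLp.ofLp_smul, Finset.sum_apply, Pi.smul_apply, smul_eq_mul,
    EuclideanSpace.inner_eq_star_dotProduct]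
  exact Finset.sum_congr rfl fun k _ => by
    rw [mul_comm]; congr 1; exact Finset.sum_congr rfl fun b _ => by simp [mul_comm]

variable {u : κ → EuclideanSpace ℝ (Fin p)} {W : Submodule ℝ (EuclideanSpace ℝ (Fin p))}

theorem exists_orthonormal (hW : Module.finrank ℝ W = Fintype.card κ) :
    ∃ u : κ → EuclideanSpace ℝ (Fin p), Orthonormal ℝ u ∧ ∀ k, u k ∈ W := by
  let b := (stdOrthonormalBasis ℝ W).reindex
    ((finCongr hW).trans (Fintype.equivFin κ).symm)
  exact ⟨fun k => b k, b.orthonormal.comp_linearIsometry W.subtypeₗᵢ, fun k => (b k).2⟩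

variable [DecidableEq κ]

/-- For an orthonormal basis `u` of `W`, the matrix `∑ uₖ uₖᵀ` is the projection onto `W`. -/
theorem toEuclideanLin_colMatrix_eq_self_iff (hu : Orthonormal ℝ u) (huW : ∀ k, u k ∈ W)
    (hW : Module.finrank ℝ W = Fintype.card κ) (x : EuclideanSpace ℝ (Fin p)) :
    toEuclideanLin (colMatrix u * (colMatrix u)ᵀ) x = x ↔ x ∈ W := by
  constructor
  · intro h
    rw [← h, toEuclideanLin_colMatrix]
    exact W.sum_mem fun k _ => W.smul_mem _ (huW k)
  · intro hx
    have hspan : Submodule.span ℝ (range u) = W :=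
      Submodule.eq_of_le_of_finrank_eq (Submodule.span_le.2 (range_subset_iff.2 huW))
        ((finrank_span_eq_card hu.linearIndependent).trans hW.symm)
    have hle : Submodule.span ℝ (range u) ≤ LinearMap.eqLocus
        (toEuclideanLin (colMatrix u * (colMatrix u)ᵀ)) LinearMap.id := by
      refine Submodule.span_le.2 (range_subset_iff.2 fun k => ?_)
      change toEuclideanLin _ (u k) = u k
      rw [toEuclideanLin_colMatrix]
      simp [orthonormal_iff_ite.1 hu]
    rw [← hspan] at hx
    exact hle hx

theorem toEuclideanLin_negOn (x : EuclideanSpace ℝ (Fin p)) :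
    toEuclideanLin (negOn (colMatrix u)) x
      = x - (2 : ℝ) • toEuclideanLin (colMatrix u * (colMatrix u)ᵀ) x := by
  simp [negOn, toLpLin_one]

theorem toEuclideanLin_negOn_eq_neg_iff (hu : Orthonormal ℝ u) (huW : ∀ k, u k ∈ W)
    (hW : Module.finrank ℝ W = Fintype.card κ) (x : EuclideanSpace ℝ (Fin p)) :
    toEuclideanLin (negOn (colMatrix u)) x = -x ↔ x ∈ W := by
  rw [toEuclideanLin_negOn, ← toEuclideanLin_colMatrix_eq_self_iff hu huW hW, sub_eq_iff_eq_add,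
    neg_add_eq_sub, eq_sub_iff_add_eq, ← two_smul ℝ x, eq_comm]
  exact (smul_right_injective _ (two_ne_zero' ℝ)).eq_iff

/-- A symmetric involution is determined by its `(-1)`-eigenspace. -/
theorem eq_negOn {R : Matrix (Fin p) (Fin p) ℝ} (hT : Rᵀ = R) (hR : R * R = 1)
    (hRW : ∀ x, toEuclideanLin R x = -x ↔ x ∈ W) (hu : Orthonormal ℝ u) (huW : ∀ k, u k ∈ W)
    (hW : Module.finrank ℝ W = Fintype.card κ) : R = negOn (colMatrix u) := by
  set M := colMatrix u with hM
  have hRM : R * M = -M := by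
    ext a k
    have := congrArg (fun x : EuclideanSpace ℝ (Fin p) => x a) ((hRW (u k)).2 (huW k))
    exact this
  -- the columns of `1 - R` lie in `W`
  have hQ : M * Mᵀ * (1 - R) = 1 - R := by
    ext a j
    set x : EuclideanSpace ℝ (Fin p) := WithLp.toLp 2 fun b => (1 - R) b j with hx
    have hxW : x ∈ W := by
      refine (hRW x).1 ?_
      ext b
      have h : R * (1 - R) = -(1 - R) := by rw [Matrix.mul_sub, hR]; simp
      exact congrFun (congrFun h b) j
    exact congrArg (fun x : EuclideanSpace ℝ (Fin p) => x a)
      ((toEuclideanLin_colMatrix_eq_self_iff hu huW hW x).2 hxW)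
  have hMR : Mᵀ * R = -Mᵀ := by simpa [transpose_mul, hT] using congrArg transpose hRM
  have h2 : 1 - R = (2 : ℝ) • (M * Mᵀ) := by
    rw [← hQ, Matrix.mul_assoc, Matrix.mul_sub, hMR, Matrix.mul_one, sub_neg_eq_add,
      Matrix.mul_add, two_smul]
  rw [negOn, ← h2]
  abel

end ColMatrix

/-! ### Reducibility and the Grassmannian distance -/

section Distance

variable {p : ℕ}

theorem IsInvolution.mul_self {R : SO p} (hR : IsInvolution R) :
    (R : Matrix (Fin p) (Fin p) ℝ) * R = 1 := by
  have := congrArg (fun A : SO p => (A : Matrix (Fin p) (Fin p) ℝ)) hR.1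
  simpa [sq] using this

theorem IsInvolution.transpose_eq {R : SO p} (hR : IsInvolution R) :
    (R : Matrix (Fin p) (Fin p) ℝ)ᵀ = R := by
  have h := congrArg (· * (R : Matrix (Fin p) (Fin p) ℝ)) (transpose_mul_self_coe R)
  simpa [Matrix.mul_assoc, hR.mul_self] using h

/-- The support of the negative entries of a sign change of level `m`. -/
def signSupport {m : ℕ} (σ : EvenSign p) (hσ : signLevel σ = m) :
    {J : Finset (Fin p) // J.card = m} := ⟨Finset.univ.filter fun i => σ.1 i = -1, hσ⟩

theorem toEuclideanLin_signMatrix_eq_neg_iff {m : ℕ} (σ : EvenSign p) (hσ : signLevel σ = m)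
    (x : EuclideanSpace ℝ (Fin p)) :
    toEuclideanLin (signMatrix σ : Matrix (Fin p) (Fin p) ℝ) x = -x ↔
      x ∈ (coordPlane (signSupport σ hσ)).1 := by
  have h : ∀ i, toEuclideanLin (signMatrix σ : Matrix (Fin p) (Fin p) ℝ) x i
      = ((σ.1 i : ℤ) : ℝ) * x i := fun i => by
    rw [toLpLin_apply]
    exact mulVec_diagonal _ _ i
  have hmem : x ∈ (coordPlane (signSupport σ hσ)).1 ↔ ∀ i, σ.1 i ≠ -1 → x i = 0 := by
    change (∀ i, i ∉ (Finset.univ.filter fun i => σ.1 i = -1) → x i = 0) ↔ _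
    simp
  rw [hmem, PiLp.ext_iff]
  refine forall_congr' fun i => ?_
  rw [h, PiLp.neg_apply]
  rcases Int.units_eq_one_or (σ.1 i) with h1 | h1
  · have : (1 : ℤˣ) ≠ -1 := by decide
    simp [h1, this, self_eq_neg]
  · simp [h1]

/-- The product of `R` with a sign change of the same level has twice the Grassmannian distance of
the two `(-1)`-eigenspaces as its geodesic distance from the identity. -/
theorem dSO_mul_signMatrix {m : ℕ} {R : SO p} (hR : IsInvolution R) (W : Gr m p)
    (hRW : ∀ x, toEuclideanLin (R : Matrix (Fin p) (Fin p) ℝ) x = -x ↔ x ∈ W.1)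
    (σ : EvenSign p) (hσ : signLevel σ = m) :
    dSO (R * signMatrix σ) 1 = 2 * dGr W (coordPlane (signSupport σ hσ)) := by
  set Z := coordPlane (signSupport σ hσ)
  have h := isPrincipalSystem_principalVectors W Z
  have hS : (signMatrix σ : Matrix (Fin p) (Fin p) ℝ)
      = negOn (colMatrix (principalVectors W Z).2) := by
    refine eq_negOn ?_ ?_ (toEuclideanLin_signMatrix_eq_neg_iff σ hσ) h.right_orthonormal
      h.right_mem (by rw [Fintype.card_fin]; exact Z.2)
    · exact diagonal_transpose _
    · rw [signMatrix, diagonal_mul_diagonal, ← diagonal_one]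
      congr 1
      funext i
      rcases Int.units_eq_one_or (σ.1 i) with h | h <;> simp [h]
  refine dSO_negOn_mul_negOn (transpose_colMatrix_mul_self h.left_orthonormal)
    (transpose_colMatrix_mul_self h.right_orthonormal) (φ := principalAngle W Z)
    (fun k => ⟨Real.arccos_nonneg _, Real.arccos_le_pi_div_two.2 (h.inner_nonneg k)⟩) ?_ ?_
  · rw [transpose_colMatrix_mul]
    ext i j
    rw [of_apply, diagonal_apply]
    split_ifs with hij
    · subst hij
      have hab := abs_le.1 (abs_real_inner_le_norm ((principalVectors W Z).1 i)
        ((principalVectors W Z).2 i))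
      rw [h.left_orthonormal.1, h.right_orthonormal.1, one_mul] at hab
      exact (Real.cos_arccos hab.1 hab.2).symm
    · exact h.inner_eq_zero hij
  · rw [← hS, ← eq_negOn hR.transpose_eq hR.mul_self hRW h.left_orthonormal h.left_mem
      (by rw [Fintype.card_fin]; exact W.2)]
    rfl

/-- Halving an orthonormal basis of the `(-1)`-eigenspace writes an involution of level `2 n` as
the product of two involutions of level `n` with orthogonal `(-1)`-eigenspaces, all of whose
principal angles are `π / 2`. -/
theorem dSO_involution {n : ℕ} {R : SO p} (hR : IsInvolution R) (W : Gr (n + n) p)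
    (hRW : ∀ x, toEuclideanLin (R : Matrix (Fin p) (Fin p) ℝ) x = -x ↔ x ∈ W.1) :
    dSO R 1 = 2 * √(n * (Real.pi / 2) ^ 2) := by
  have hW : Module.finrank ℝ W.1 = Fintype.card (Fin n ⊕ Fin n) := by
    rw [Fintype.card_sum, Fintype.card_fin]; exact W.2
  obtain ⟨u, hu, huW⟩ := exists_orthonormal hW
  have hMV : (colMatrix (u ∘ Sum.inl))ᵀ * colMatrix (u ∘ Sum.inr) = 0 := by
    rw [transpose_colMatrix_mul]
    ext i j
    exact hu.2 Sum.inl_ne_inr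
  have hsum : colMatrix u * (colMatrix u)ᵀ
      = colMatrix (u ∘ Sum.inl) * (colMatrix (u ∘ Sum.inl))ᵀ
        + colMatrix (u ∘ Sum.inr) * (colMatrix (u ∘ Sum.inr))ᵀ := by
    ext a b
    simp only [mul_apply, Matrix.add_apply, Fintype.sum_sum_type]
    rfl
  have hprod : negOn (colMatrix u)
      = negOn (colMatrix (u ∘ Sum.inl)) * negOn (colMatrix (u ∘ Sum.inr)) := by
    simp only [negOn, hsum]
    have h0 : colMatrix (u ∘ Sum.inl) * (colMatrix (u ∘ Sum.inl))ᵀ *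
        (colMatrix (u ∘ Sum.inr) * (colMatrix (u ∘ Sum.inr))ᵀ) = 0 := by
      rw [Matrix.mul_assoc, ← Matrix.mul_assoc (colMatrix (u ∘ Sum.inl))ᵀ, hMV]; simp
    simp only [Matrix.sub_mul, Matrix.mul_sub, Matrix.smul_mul, Matrix.mul_smul, h0, smul_add,
      smul_zero, Matrix.mul_one, Matrix.one_mul, sub_zero]
    abel
  rw [dSO_negOn_mul_negOn (φ := fun _ : Fin n => Real.pi / 2)
    (transpose_colMatrix_mul_self (hu.comp _ Sum.inl_injective))
    (transpose_colMatrix_mul_self (hu.comp _ Sum.inr_injective))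
    (fun _ => ⟨by positivity, le_rfl⟩) (by simpa using hMV)
    ((eq_negOn hR.transpose_eq hR.mul_self hRW hu huW hW).trans hprod)]
  simp

/-- Reducibility by a sign change, as a condition on the Grassmannian distance. -/
theorem dSO_lt_iff {m : ℕ} (hm : Even m) {R : SO p} (hR : IsInvolution R) (W : Gr m p)
    (hRW : ∀ x, toEuclideanLin (R : Matrix (Fin p) (Fin p) ℝ) x = -x ↔ x ∈ W.1)
    (σ : EvenSign p) (hσ : signLevel σ = m) :
    dSO (R * signMatrix σ) 1 < dSO R 1 ↔
      dGr W (coordPlane (signSupport σ hσ)) ^ 2 < (m : ℝ) * Real.pi ^ 2 / 8 := by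
  obtain ⟨n, rfl⟩ := hm
  rw [dSO_mul_signMatrix hR W hRW σ hσ, dSO_involution hR W hRW,
    mul_lt_mul_iff_of_pos_left zero_lt_two, Real.lt_sqrt (show 0 ≤ dGr W _ from Real.sqrt_nonneg _)]
  have : (n : ℝ) * (Real.pi / 2) ^ 2 = ((n + n : ℕ) : ℝ) * Real.pi ^ 2 / 8 := by
    push_cast; ring
  rw [this]

/-- Every even-dimensional subspace is the `(-1)`-eigenspace of an involution. -/
theorem exists_involution {m : ℕ} (hm : Even m) (hm0 : 0 < m) (W : Gr m p) :
    ∃ R : SO p, IsInvolution R ∧ level R = m ∧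
      ∀ x, toEuclideanLin (R : Matrix (Fin p) (Fin p) ℝ) x = -x ↔ x ∈ W.1 := by
  have hW : Module.finrank ℝ W.1 = Fintype.card (Fin m) := by rw [Fintype.card_fin]; exact W.2
  obtain ⟨u, hu, huW⟩ := exists_orthonormal hW
  have hM := transpose_colMatrix_mul_self hu
  have hsq := negOn_mul_self hM
  let R : SO p := ⟨negOn (colMatrix u), by
    rw [mem_specialOrthogonalGroup_iff, mem_orthogonalGroup_iff, transpose_negOn, det_negOn hM,
      Fintype.card_fin]
    exact ⟨hsq, hm.neg_one_pow⟩⟩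
  have hRW : ∀ x, toEuclideanLin (R : Matrix (Fin p) (Fin p) ℝ) x = -x ↔ x ∈ W.1 :=
    toEuclideanLin_negOn_eq_neg_iff hu huW hW
  refine ⟨R, ⟨Subtype.ext ((sq _).trans hsq), fun h => ?_⟩, ?_, hRW⟩
  · have h0 := (hRW (u ⟨0, hm0⟩)).2 (huW _)
    rw [h] at h0
    have h1 : u ⟨0, hm0⟩ = -u ⟨0, hm0⟩ := by simpa [toLpLin_one] using h0
    rw [eq_neg_iff_add_eq_zero, ← two_smul ℝ] at h1
    exact hu.ne_zero ⟨0, hm0⟩ ((smul_eq_zero.1 h1).resolve_left two_ne_zero)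
  · have : Module.End.eigenspace (toEuclideanLin (R : Matrix (Fin p) (Fin p) ℝ)) (-1) = W.1 := by
      ext x
      rw [Module.End.mem_eigenspace_iff, neg_one_smul, hRW]
    rw [level, this]
    exact W.2

/-- Every even-sized set of indices is the support of the negative entries of a sign change. -/
theorem exists_signSupport_eq {m : ℕ} (hm : Even m) (J : {J : Finset (Fin p) // J.card = m}) :
    ∃ (σ : EvenSign p) (hσ : signLevel σ = m), signSupport σ hσ = J := by
  have hJ : (Finset.univ.filter fun i => (if i ∈ J.1 then (-1 : ℤˣ) else 1) = -1) = J.1 := by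
    ext i
    have : (1 : ℤˣ) ≠ -1 := by decide
    by_cases hi : i ∈ J.1 <;> simp [hi, this]
  refine ⟨⟨fun i => if i ∈ J.1 then -1 else 1, ?_⟩, ?_, Subtype.ext hJ⟩
  · rw [Finset.prod_ite_mem, Finset.univ_inter, Finset.prod_const, J.2, hm.neg_one_pow]
  · exact (congrArg Finset.card hJ).trans J.2

end Distance

end SignChange

theorem mainTheorem7 (m p : ℕ) (hm : Even m) (hm0 : 0 < m) (hmp : m ≤ p) :
    (∀ R : SO p, IsInvolution R → level R = m → ReducibleBySignChange m R) ↔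
      (∀ W : Gr m p, ∃ J : {J : Finset (Fin p) // J.card = m},
        dGr W (coordPlane J) ^ 2 < (m : ℝ) * Real.pi ^ 2 / 8) := by
  constructor
  · intro h W
    obtain ⟨R, hR, hl, hRW⟩ := exists_involution hm hm0 W
    obtain ⟨σ, hσ, hlt⟩ := h R hR hl
    exact ⟨signSupport σ hσ, (dSO_lt_iff hm hR W hRW σ hσ).1 hlt⟩
  · intro h R hR hl
    let W : Gr m p := ⟨_, hl⟩
    have hRW : ∀ x, Matrix.toEuclideanLin (R : Matrix (Fin p) (Fin p) ℝ) x = -x ↔ x ∈ W.1 :=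
      fun x => by rw [Module.End.mem_eigenspace_iff, neg_one_smul]
    obtain ⟨J, hJ⟩ := h W
    obtain ⟨σ, hσ, rfl⟩ := exists_signSupport_eq hm J
    exact ⟨σ, hσ, (dSO_lt_iff hm hR W hRW σ hσ).2 hJ⟩
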